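/- Let $q\in\mathbb{C}$ with $0<|q|<1$, and let $\zeta_3:=e^{2\pi i/3}$. Write $(x;q)_n:=\prod_{i=0}^{n-1}(1-q^ix)$, $(x;q)_\infty:=\prod_{i\ge 0}(1-q^ix)$ and, for positive integers $a$, $J_a:=\prod_{i\ge 1}(1-q^{ai})$. Let $$f_3(q):=\sum_{n\ge 0}\frac{q^{n^2}}{(-q;q)_n^2}$$ be the third-order mock theta function. Then $$f_3(q^3)=\frac13\,\frac{J_1^4}{J_3J_2^2}+\frac43\,\frac{1}{(q^3;q^3)_\infty}\sum_{n\in\mathbb{Z}}\frac{(-1)^n\zeta_3^{\,n}q^{n(n+1)/2}}{1+q^n},$$ where all the infinite products converge, both series converge absolutely, and no denominator vanishes. -/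

import Mathlib

noncomputable section

/-- The finite `q`-Pochhammer symbol `(x; q)_n = ∏_{i=0}^{n-1} (1 - q^i x)`. -/
def qPochhammer (x q : ℂ) (n : ℕ) : ℂ :=
  ∏ i ∈ Finset.range n, (1 - q ^ i * x)

/-- The infinite `q`-Pochhammer symbol `(x; q)_∞ = ∏_{i ≥ 0} (1 - q^i x)`. -/
def qPochhammerInf (x q : ℂ) : ℂ :=
  ∏' i : ℕ, (1 - q ^ i * x)

/-- `J_a = ∏_{i ≥ 1} (1 - q^{a i})`. -/
def eulerJ (a : ℕ) (q : ℂ) : ℂ :=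
  ∏' i : ℕ, (1 - q ^ (a * (i + 1)))

/-- The `n`-th term `q^{n^2} / (-q; q)_n^2` of the series defining `f₃(q)`. -/
def mockF3Term (q : ℂ) (n : ℕ) : ℂ :=
  q ^ (n ^ 2) / qPochhammer (-q) q n ^ 2

/-- The third-order mock theta function `f₃(q) = ∑_{n ≥ 0} q^{n^2} / (-q; q)_n^2`. -/
def mockF3 (q : ℂ) : ℂ :=
  ∑' n : ℕ, mockF3Term q n

/-- The primitive cube root of unity `ζ₃ = e^{2πi/3}`. -/
def zeta3 : ℂ :=
  Complex.exp (2 * (Real.pi : ℂ) * Complex.I / 3)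

/-- The `n`-th term `(-1)^n ζ₃^n q^{n(n+1)/2} / (1 + q^n)`, `n ∈ ℤ`, of the bilateral sum
(the integer `n (n + 1)` is even, so the integer division is exact). -/
def bilateralTerm (q : ℂ) (n : ℤ) : ℂ :=
  (-1) ^ n * zeta3 ^ n * q ^ (n * (n + 1) / 2) / (1 + q ^ n)

end

open Filter Topology Finset

/-! ### `q`-Pochhammer symbols -/

/-! Put `α_r = 4(-1)^r q^{r(r+1)/2}/(1+q^r)` for `r ≥ 1` and `α_0 = 1`. With `β_n = 1/(-q;q)_n²`
this is a Bailey pair relative to 1 (`sum_baileyAlpha`), and it is used in two limits. Inserting it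
into `∑ q^{n²} β_n` and summing over Durfee rectangles gives `f₃(q) = (q;q)_∞⁻¹ ∑ q^{r²} α_r(q)`
(`mockF3_eq_tsum_baileyAlpha`). Letting `N → ∞` in the Bailey relation itself gives `∑ α_r =
(q;q)_∞²/(-q;q)_∞² = J_1⁴/J_2²` (`tsum_baileyAlpha`).

The cube enters through `q^{3r²} α_r(q³) = α_{3r}(q)`, so `J_3 f₃(q³)` is the part of `∑ α_n(q)`
with `3 ∣ n`. The filter `(1 + ζ₃^n + ζ₃^{-n})/3` extracts it: the 1 yields the theta quotient, and
the other two terms are the two halves of the bilateral series. -/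

theorem qPochhammer_zero (x q : ℂ) : qPochhammer x q 0 = 1 := by simp [qPochhammer]

theorem qPochhammer_succ (x q : ℂ) (n : ℕ) :
    qPochhammer x q (n + 1) = qPochhammer x q n * (1 - q ^ n * x) := by
  simp [qPochhammer, prod_range_succ]

theorem qPochhammer_self_succ (q : ℂ) (n : ℕ) :
    qPochhammer q q (n + 1) = qPochhammer q q n * (1 - q ^ (n + 1)) := by
  rw [qPochhammer_succ, pow_succ]

theorem qPochhammer_neg_self_succ (q : ℂ) (n : ℕ) :
    qPochhammer (-q) q (n + 1) = qPochhammer (-q) q n * (1 + q ^ (n + 1)) := by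
  rw [qPochhammer_succ, pow_succ]; ring

theorem one_sub_ne_zero_of_norm_lt_one {z : ℂ} (hz : ‖z‖ < 1) : 1 - z ≠ 0 := by
  intro h
  rw [← sub_eq_zero.mp h, norm_one] at hz
  exact lt_irrefl _ hz

theorem one_add_ne_zero_of_norm_lt_one {z : ℂ} (hz : ‖z‖ < 1) : 1 + z ≠ 0 := by
  simpa using one_sub_ne_zero_of_norm_lt_one (z := -z) (by simpa using hz)

theorem norm_pow_lt_one {q : ℂ} (hq : ‖q‖ < 1) {n : ℕ} (hn : n ≠ 0) : ‖q ^ n‖ < 1 := by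
  rw [norm_pow]; exact pow_lt_one₀ (norm_nonneg _) hq hn

theorem one_add_pow_ne_zero {q : ℂ} (hq : ‖q‖ < 1) (n : ℕ) : 1 + q ^ n ≠ 0 := by
  rcases eq_or_ne n 0 with rfl | hn
  · norm_num
  · exact one_add_ne_zero_of_norm_lt_one (norm_pow_lt_one hq hn)

theorem norm_pow_mul_lt_one {q x : ℂ} (hq : ‖q‖ < 1) (hx : ‖x‖ < 1) (i : ℕ) :
    ‖q ^ i * x‖ < 1 := by
  rw [norm_mul, norm_pow]
  exact mul_lt_one_of_nonneg_of_lt_one_right (pow_le_one₀ (norm_nonneg _) hq.le)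
    (norm_nonneg _) hx

theorem qPochhammer_ne_zero {q x : ℂ} (hq : ‖q‖ < 1) (hx : ‖x‖ < 1) (n : ℕ) :
    qPochhammer x q n ≠ 0 :=
  prod_ne_zero_iff.mpr fun i _ =>
    one_sub_ne_zero_of_norm_lt_one (norm_pow_mul_lt_one hq hx i)

theorem summable_norm_neg_pow_mul {q : ℂ} (hq : ‖q‖ < 1) (x : ℂ) :
    Summable fun i : ℕ => ‖-(q ^ i * x)‖ := by
  simpa using (summable_geometric_of_lt_one (norm_nonneg q) hq).mul_right ‖x‖

theorem multipliable_qPochhammerInf {q : ℂ} (hq : ‖q‖ < 1) (x : ℂ) :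
    Multipliable fun i : ℕ => 1 - q ^ i * x := by
  simpa [sub_eq_add_neg] using multipliable_one_add_of_summable (summable_norm_neg_pow_mul hq x)

theorem qPochhammerInf_ne_zero {q x : ℂ} (hq : ‖q‖ < 1) (hx : ‖x‖ < 1) :
    qPochhammerInf x q ≠ 0 := by
  have := tprod_one_add_ne_zero_of_summable (f := fun i : ℕ => -(q ^ i * x))
    (fun i => by
      simpa [sub_eq_add_neg] using one_sub_ne_zero_of_norm_lt_one (norm_pow_mul_lt_one hq hx i))
    (summable_norm_neg_pow_mul hq x)
  simpa [sub_eq_add_neg, qPochhammerInf] using this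

theorem tendsto_qPochhammer {q : ℂ} (hq : ‖q‖ < 1) (x : ℂ) :
    Tendsto (qPochhammer x q) atTop (𝓝 (qPochhammerInf x q)) :=
  (multipliable_qPochhammerInf hq x).hasProd.tendsto_prod_nat

theorem exists_norm_inv_qPochhammer_le {q x : ℂ} (hq : ‖q‖ < 1) (hx : ‖x‖ < 1) :
    ∃ K : ℝ, 0 ≤ K ∧ ∀ n, ‖(qPochhammer x q n)⁻¹‖ ≤ K := by
  obtain ⟨K, hK⟩ :=
    ((tendsto_qPochhammer hq x).inv₀ (qPochhammerInf_ne_zero hq hx)).norm.bddAbove_range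
  have h : ∀ n, ‖(qPochhammer x q n)⁻¹‖ ≤ K := fun n => hK ⟨n, rfl⟩
  exact ⟨K, (norm_nonneg _).trans (h 0), h⟩

theorem eulerJ_factor (a : ℕ) (q : ℂ) (i : ℕ) :
    1 - q ^ (a * (i + 1)) = 1 - (q ^ a) ^ i * q ^ a := by
  rw [pow_mul, pow_succ]

theorem eulerJ_eq_qPochhammerInf (a : ℕ) (q : ℂ) :
    eulerJ a q = qPochhammerInf (q ^ a) (q ^ a) := by
  simp only [eulerJ, qPochhammerInf, eulerJ_factor]

theorem eulerJ_two_eq {q : ℂ} (hq : ‖q‖ < 1) :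
    eulerJ 2 q = qPochhammerInf q q * qPochhammerInf (-q) q := by
  rw [qPochhammerInf, qPochhammerInf,
    ← (multipliable_qPochhammerInf hq q).tprod_mul (multipliable_qPochhammerInf hq (-q)), eulerJ]
  exact tprod_congr fun i => by ring

/-! ### A finite Bailey pair relative to `1` -/

theorem triangle_succ (n : ℕ) : (n + 1) * (n + 1 + 1) / 2 = n * (n + 1) / 2 + (n + 1) := by
  rw [show (n + 1) * (n + 1 + 1) = n * (n + 1) + (n + 1) * 2 by ring]
  exact Nat.add_mul_div_right _ _ two_pos

theorem le_triangle (n : ℕ) : n ≤ n * (n + 1) / 2 := by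
  induction n with
  | zero => simp
  | succ n ih => rw [triangle_succ]; omega

/-- The unit Bailey sequence relative to `1`. -/
noncomputable def unitBaileyAlpha (q : ℂ) : ℕ → ℂ
  | 0 => 1
  | r + 1 => (-1) ^ (r + 1) * q ^ (r * (r + 1) / 2) * (1 + q ^ (r + 1))

/-- The coefficients `α_r` of the Bailey pair relative to `1` with `β_n = 1 / (-q; q)_n²`. -/
noncomputable def baileyAlpha (q : ℂ) : ℕ → ℂ
  | 0 => 1
  | r + 1 => 4 * (-1) ^ (r + 1) * q ^ ((r + 1) * (r + 1 + 1) / 2) / (1 + q ^ (r + 1))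

/-- Links the pair to the unit pair; this is what drives the induction in `sum_baileyAlpha`. -/
theorem baileyAlpha_mul_sq {q : ℂ} (hq : ‖q‖ < 1) (r : ℕ) :
    baileyAlpha q r * (1 + q ^ r) ^ 2 = 4 * unitBaileyAlpha q r * q ^ r := by
  cases r with
  | zero => norm_num [baileyAlpha, unitBaileyAlpha]
  | succ r =>
    have := one_add_pow_ne_zero hq (r + 1)
    rw [baileyAlpha, unitBaileyAlpha, triangle_succ, pow_add q (r * (r + 1) / 2)]
    field_simp

/-- The unit-pair sum telescopes. Writing `N = k + 1 + d` keeps the partial sum strictly short of `r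
= N` and avoids truncated subtraction in the induction. -/
theorem sum_unitBaileyAlpha_partial {q : ℂ} (hq : ‖q‖ < 1) (k d : ℕ) :
    ∑ r ∈ range (k + 1), unitBaileyAlpha q r /
        (qPochhammer q q (k + 1 + d - r) * qPochhammer q q (k + 1 + d + r)) =
      (-1) ^ k * q ^ (k * (k + 1) / 2) / ((1 - q ^ (k + 1 + d)) *
        (qPochhammer q q d * qPochhammer q q (k + 1 + d + k))) := by
  have hu := qPochhammer_ne_zero hq hq
  have h1 (n : ℕ) : 1 - q ^ (n + 1) ≠ 0 :=
    one_sub_ne_zero_of_norm_lt_one (norm_pow_lt_one hq n.succ_ne_zero)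
  induction k generalizing d with
  | zero =>
    have := h1 d
    have := hu d
    simp only [zero_add, sum_range_one, unitBaileyAlpha, add_comm 1 d, Nat.sub_zero, add_zero,
      qPochhammer_self_succ]
    field_simp
    simp
  | succ k ih =>
    have e := ih (d + 1)
    rw [show k + 1 + (d + 1) = k + 1 + 1 + d by ring] at e
    rw [sum_range_succ, e, triangle_succ, unitBaileyAlpha,
      show k + 1 + 1 + d - (k + 1) = d + 1 by omega,
      show k + 1 + 1 + d + (k + 1) = k + 1 + 1 + d + k + 1 by ring,
      qPochhammer_self_succ, qPochhammer_self_succ]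
    have a1 := h1 d
    have a2 := h1 (k + 1 + d)
    have a3 := h1 (k + 1 + 1 + d + k)
    have a4 := hu d
    have a5 := hu (k + 1 + 1 + d + k)
    rw [show k + 1 + d + 1 = k + 1 + 1 + d by ring] at a2
    field_simp
    ring

theorem sum_unitBaileyAlpha {q : ℂ} (hq : ‖q‖ < 1) (N : ℕ) :
    ∑ r ∈ range (N + 1 + 1), unitBaileyAlpha q r /
        (qPochhammer q q (N + 1 - r) * qPochhammer q q (N + 1 + r)) = 0 := by
  have hu := qPochhammer_ne_zero hq hq
  have h1 (n : ℕ) : 1 - q ^ (n + 1) ≠ 0 :=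
    one_sub_ne_zero_of_norm_lt_one (norm_pow_lt_one hq n.succ_ne_zero)
  have e := sum_unitBaileyAlpha_partial hq N 0
  rw [add_zero] at e
  rw [sum_range_succ, e, unitBaileyAlpha, Nat.sub_self, qPochhammer_zero,
    show N + 1 + (N + 1) = N + 1 + N + 1 by ring, qPochhammer_self_succ]
  have a1 := h1 N
  have a2 := h1 (N + 1 + N)
  have a3 := hu (N + 1 + N)
  field_simp
  ring

theorem sum_baileyAlpha {q : ℂ} (hq : ‖q‖ < 1) (N : ℕ) :
    ∑ r ∈ range (N + 1), baileyAlpha q r /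
        (qPochhammer q q (N - r) * qPochhammer q q (N + r)) =
      1 / qPochhammer (-q) q N ^ 2 := by
  have hu := qPochhammer_ne_zero hq hq
  have h1 (n : ℕ) : 1 - q ^ (n + 1) ≠ 0 :=
    one_sub_ne_zero_of_norm_lt_one (norm_pow_lt_one hq n.succ_ne_zero)
  induction N with
  | zero => simp [baileyAlpha, qPochhammer_zero]
  | succ N ih =>
    have hv := qPochhammer_ne_zero (x := -q) hq (by simpa using hq) N
    have hQ := one_add_pow_ne_zero hq (N + 1)
    -- With `Q = q^(N+1)`: `(1+Q)² - (1-Qq^{-r})(1-Qq^r) = Q q^{-r} (1+q^r)²`, and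
    -- `baileyAlpha_mul_sq` turns the excess into a unit-pair term, whose total vanishes.
    have key : ∀ r ∈ range (N + 1), baileyAlpha q r /
        (qPochhammer q q (N + 1 - r) * qPochhammer q q (N + 1 + r)) * (1 + q ^ (N + 1)) ^ 2 =
        baileyAlpha q r / (qPochhammer q q (N - r) * qPochhammer q q (N + r)) +
        4 * q ^ (N + 1) * (unitBaileyAlpha q r /
        (qPochhammer q q (N + 1 - r) * qPochhammer q q (N + 1 + r))) := by
      intro r hr
      obtain ⟨d, rfl⟩ := Nat.exists_eq_add_of_le (Nat.lt_succ_iff.mp (mem_range.mp hr))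
      rw [show r + d + 1 - r = d + 1 by omega, show r + d - r = d by omega,
        show r + d + 1 + r = r + d + r + 1 by ring, qPochhammer_self_succ, qPochhammer_self_succ]
      have a1 := h1 d
      have a2 := h1 (r + d + r)
      have a3 := hu d
      have a4 := hu (r + d + r)
      have b := baileyAlpha_mul_sq hq r
      field_simp
      linear_combination q ^ (d + 1) * b
    have last : baileyAlpha q (N + 1) /
        (qPochhammer q q (N + 1 - (N + 1)) * qPochhammer q q (N + 1 + (N + 1))) *
          (1 + q ^ (N + 1)) ^ 2 = 4 * q ^ (N + 1) * (unitBaileyAlpha q (N + 1) /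
        (qPochhammer q q (N + 1 - (N + 1)) * qPochhammer q q (N + 1 + (N + 1)))) := by
      rw [div_mul_eq_mul_div, baileyAlpha_mul_sq hq]; ring
    rw [qPochhammer_neg_self_succ, mul_pow, eq_div_iff (by positivity), mul_comm (_ ^ 2),
      ← mul_assoc, sum_mul, sum_range_succ, sum_congr rfl key, sum_add_distrib, ih, last, add_assoc,
      ← mul_sum, ← mul_add, ← sum_range_succ (fun r => unitBaileyAlpha q r /
        (qPochhammer q q (N + 1 - r) * qPochhammer q q (N + 1 + r))) (N + 1),
      sum_unitBaileyAlpha hq]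
    field_simp
    simp

/-! ### Sums over Durfee rectangles -/

/-- The summand `q^{m(m+k)} / ((q; q)_m (q; q)_{m+k})`. -/
noncomputable def durfeeTerm (q : ℂ) (k m : ℕ) : ℂ :=
  q ^ (m * (m + k)) / (qPochhammer q q m * qPochhammer q q (m + k))

theorem norm_pow_div_le {q a b : ℂ} {K : ℝ} (hq : ‖q‖ < 1) (ha : ‖a⁻¹‖ ≤ K) (hb : ‖b⁻¹‖ ≤ K)
    {e n : ℕ} (h : n ≤ e) : ‖q ^ e / (a * b)‖ ≤ K ^ 2 * ‖q‖ ^ n := by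
  rw [div_eq_mul_inv, mul_inv, norm_mul, norm_mul, norm_pow, mul_comm, sq]
  have hK := (norm_nonneg _).trans ha
  exact mul_le_mul (mul_le_mul ha hb (norm_nonneg _) hK)
    (pow_le_pow_of_le_one (norm_nonneg _) hq.le h) (by positivity) (mul_nonneg hK hK)

theorem norm_durfeeTerm_le {q : ℂ} {K : ℝ} (hq : ‖q‖ < 1)
    (hK : ∀ n, ‖(qPochhammer q q n)⁻¹‖ ≤ K) (k m : ℕ) :
    ‖durfeeTerm q k m‖ ≤ K ^ 2 * ‖q‖ ^ m :=
  norm_pow_div_le hq (hK _) (hK _) (by nlinarith [Nat.zero_le (m * k), Nat.le_mul_self m])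

theorem summable_durfeeTerm {q : ℂ} (hq : ‖q‖ < 1) (k : ℕ) : Summable (durfeeTerm q k) := by
  obtain ⟨K, -, hK⟩ := exists_norm_inv_qPochhammer_le hq hq
  exact .of_norm_bounded ((summable_geometric_of_lt_one (norm_nonneg q) hq).mul_left _)
    (norm_durfeeTerm_le hq hK k)

/-- Over a common denominator the left side acquires the factor `1 - q^(m+1)`, which lowers
`(q;q)_{m+1}` to `(q;q)_m`. -/
theorem durfeeTerm_recurrence {q : ℂ} (hq : ‖q‖ < 1) (k m : ℕ) :
    durfeeTerm q k (m + 1) - durfeeTerm q (k + 1) (m + 1) +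
      q ^ (k + 1) * durfeeTerm q (k + 1) (m + 1) = q ^ (k + 1) * durfeeTerm q (k + 2) m := by
  have hu := qPochhammer_ne_zero hq hq
  have h1 (n : ℕ) : 1 - q ^ (n + 1) ≠ 0 :=
    one_sub_ne_zero_of_norm_lt_one (norm_pow_lt_one hq n.succ_ne_zero)
  simp only [durfeeTerm]
  rw [show m + 1 + (k + 1) = m + 1 + k + 1 by ring, show m + (k + 2) = m + 1 + k + 1 by ring,
    qPochhammer_self_succ, qPochhammer_self_succ]
  have a1 := h1 m
  have a2 := h1 (m + 1 + k)
  have a3 := hu m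
  have a4 := hu (m + 1 + k)
  field_simp
  ring

theorem tsum_durfeeTerm_recurrence {q : ℂ} (hq : ‖q‖ < 1) (k : ℕ) :
    ∑' m, durfeeTerm q k m - ∑' m, durfeeTerm q (k + 1) m =
      -q ^ (k + 1) * (∑' m, durfeeTerm q (k + 1) m - ∑' m, durfeeTerm q (k + 2) m) := by
  have s := summable_durfeeTerm hq
  have s1 := ((s k).sub (s (k + 1))).add ((s (k + 1)).mul_left (q ^ (k + 1)))
  have e := s1.tsum_eq_zero_add
  rw [((s k).sub (s (k + 1))).tsum_add ((s (k + 1)).mul_left (q ^ (k + 1))),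
    (s k).tsum_sub (s (k + 1)), tsum_mul_left] at e
  simp only [durfeeTerm_recurrence hq] at e
  rw [tsum_mul_left] at e
  have h0 : durfeeTerm q k 0 - durfeeTerm q (k + 1) 0 + q ^ (k + 1) * durfeeTerm q (k + 1) 0 =
      0 := by
    have h1 : 1 - q ^ (k + 1) ≠ 0 :=
      one_sub_ne_zero_of_norm_lt_one (norm_pow_lt_one hq k.succ_ne_zero)
    have h2 := qPochhammer_ne_zero hq hq k
    simp only [durfeeTerm, zero_add, qPochhammer_self_succ, qPochhammer_zero, zero_mul, pow_zero]
    field_simp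
    ring
  rw [h0] at e
  linear_combination e

/-- Consecutive differences shrink by a factor of norm at most `‖q‖` at each iteration of the
recurrence, while the sums are bounded uniformly in `k`; hence the differences vanish. -/
theorem tsum_durfeeTerm_succ {q : ℂ} (hq : ‖q‖ < 1) (k : ℕ) :
    ∑' m, durfeeTerm q (k + 1) m = ∑' m, durfeeTerm q k m := by
  obtain ⟨K, -, hK⟩ := exists_norm_inv_qPochhammer_le hq hq
  have hS (k : ℕ) : ‖∑' m, durfeeTerm q k m‖ ≤ K ^ 2 * (1 - ‖q‖)⁻¹ :=
    tsum_of_norm_bounded ((hasSum_geometric_of_lt_one (norm_nonneg q) hq).mul_left _)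
      (norm_durfeeTerm_le hq hK k)
  have hD (n : ℕ) : ∀ k, ‖∑' m, durfeeTerm q k m - ∑' m, durfeeTerm q (k + 1) m‖ ≤
      ‖q‖ ^ n * (K ^ 2 * (1 - ‖q‖)⁻¹ + K ^ 2 * (1 - ‖q‖)⁻¹) := by
    induction n with
    | zero =>
      intro k
      simpa using (norm_sub_le _ _).trans (add_le_add (hS k) (hS (k + 1)))
    | succ n ih =>
      intro k
      rw [tsum_durfeeTerm_recurrence hq, norm_mul, norm_neg, norm_pow, pow_succ' _ n, mul_assoc]
      gcongr
      · exact pow_le_of_le_one (norm_nonneg _) hq.le k.succ_ne_zero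
      · exact ih (k + 1)
  have lim := (tendsto_pow_atTop_nhds_zero_of_lt_one (norm_nonneg q) hq).mul_const
    (K ^ 2 * (1 - ‖q‖)⁻¹ + K ^ 2 * (1 - ‖q‖)⁻¹)
  rw [zero_mul] at lim
  exact (sub_eq_zero.mp (norm_le_zero_iff.mp (ge_of_tendsto' lim fun n => hD n k))).symm

/-- The sum is independent of `k`, and as `k → ∞` only the `m = 0` term survives. -/
theorem tsum_durfeeTerm {q : ℂ} (hq : ‖q‖ < 1) (k : ℕ) :
    ∑' m, durfeeTerm q k m = (qPochhammerInf q q)⁻¹ := by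
  obtain ⟨K, -, hK⟩ := exists_norm_inv_qPochhammer_le hq hq
  have const (n : ℕ) : ∑' m, durfeeTerm q n m = ∑' m, durfeeTerm q 0 m := by
    induction n with
    | zero => rfl
    | succ n ih => rw [tsum_durfeeTerm_succ hq, ih]
  have lim : Tendsto (fun n => ∑' m, durfeeTerm q n m) atTop
      (𝓝 (∑' m, if m = 0 then (qPochhammerInf q q)⁻¹ else 0)) := by
    refine tendsto_tsum_of_dominated_convergence
      ((summable_geometric_of_lt_one (norm_nonneg q) hq).mul_left (K ^ 2)) (fun m => ?_)
      (.of_forall fun n => norm_durfeeTerm_le hq hK n)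
    rcases eq_or_ne m 0 with rfl | hm
    · simpa [durfeeTerm, qPochhammer_zero] using
        (tendsto_qPochhammer hq q).inv₀ (qPochhammerInf_ne_zero hq hq)
    · rw [if_neg hm]
      have h0 := (tendsto_pow_atTop_nhds_zero_of_lt_one (norm_nonneg q) hq).const_mul (K ^ 2)
      rw [mul_zero] at h0
      refine squeeze_zero_norm (fun n => ?_) h0
      refine norm_pow_div_le hq (hK _) (hK _) ?_
      nlinarith [Nat.one_le_iff_ne_zero.mpr hm]
  rw [tsum_ite_eq] at lim
  rw [const k]
  exact tendsto_nhds_unique (by simp only [const]; exact tendsto_const_nhds) lim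

/-! ### Limiting cases of the Bailey lemma -/

theorem norm_baileyAlpha_le {q : ℂ} (hq : ‖q‖ < 1) (r : ℕ) :
    ‖baileyAlpha q r‖ ≤ 4 * (1 - ‖q‖)⁻¹ * ‖q‖ ^ r := by
  have h0 : 0 < 1 - ‖q‖ := sub_pos.mpr hq
  have h1 : 1 ≤ (1 - ‖q‖)⁻¹ := (one_le_inv₀ h0).mpr (by linarith [norm_nonneg q])
  cases r with
  | zero => simp [baileyAlpha]; linarith
  | succ r =>
    have hd : 1 - ‖q‖ ≤ ‖1 + q ^ (r + 1)‖ := by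
      have h2 := norm_sub_norm_le (1 : ℂ) (-q ^ (r + 1))
      rw [sub_neg_eq_add, norm_one, norm_neg, norm_pow] at h2
      have : ‖q‖ ^ (r + 1) ≤ ‖q‖ := pow_le_of_le_one (norm_nonneg q) hq.le r.succ_ne_zero
      exact le_trans (by linarith) h2
    rw [baileyAlpha, norm_div, norm_mul, norm_mul, norm_pow, norm_neg, norm_one, one_pow, mul_one,
      norm_pow, div_eq_mul_inv, mul_right_comm]
    refine mul_le_mul ?_ (pow_le_pow_of_le_one (norm_nonneg _) hq.le (le_triangle _))
      (by positivity) (by positivity)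
    gcongr
    norm_num

theorem summable_baileyAlpha {q : ℂ} (hq : ‖q‖ < 1) : Summable (baileyAlpha q) :=
  .of_norm_bounded ((summable_geometric_of_lt_one (norm_nonneg q) hq).mul_left _)
    (norm_baileyAlpha_le hq)

theorem tsum_baileyAlpha {q : ℂ} (hq : ‖q‖ < 1) :
    ∑' r, baileyAlpha q r = qPochhammerInf q q ^ 2 / qPochhammerInf (-q) q ^ 2 := by
  obtain ⟨K, hK0, hK⟩ := exists_norm_inv_qPochhammer_le hq hq
  have hU := qPochhammerInf_ne_zero hq hq
  have hV := qPochhammerInf_ne_zero (x := -q) hq (by simpa using hq)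
  have tu := tendsto_qPochhammer hq q
  have lim : Tendsto (fun N => ∑' r, if r ∈ range (N + 1) then baileyAlpha q r /
      (qPochhammer q q (N - r) * qPochhammer q q (N + r)) else 0) atTop
      (𝓝 (∑' r, baileyAlpha q r / (qPochhammerInf q q * qPochhammerInf q q))) := by
    refine tendsto_tsum_of_dominated_convergence
      (((summable_geometric_of_lt_one (norm_nonneg q) hq).mul_left
        (4 * (1 - ‖q‖)⁻¹)).mul_right (K * K)) (fun r => ?_) (.of_forall fun N r => ?_)
    · have h := ((tu.comp (tendsto_sub_atTop_nat r)).mul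
        (tu.comp (tendsto_add_atTop_nat r))).inv₀ (mul_ne_zero hU hU) |>.const_mul (baileyAlpha q r)
      refine h.congr' ?_
      filter_upwards [eventually_ge_atTop r] with N hN
      rw [if_pos (mem_range.mpr (by omega))]
      rfl
    · split_ifs
      · rw [div_eq_mul_inv, mul_inv, norm_mul, norm_mul]
        exact mul_le_mul (norm_baileyAlpha_le hq r)
          (mul_le_mul (hK _) (hK _) (norm_nonneg _) hK0) (by positivity)
          ((norm_nonneg _).trans (norm_baileyAlpha_le hq r))
      · have := (norm_nonneg _).trans (norm_baileyAlpha_le hq r)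
        rw [norm_zero]; positivity
  have fin (N : ℕ) : (∑' r, if r ∈ range (N + 1) then baileyAlpha q r /
      (qPochhammer q q (N - r) * qPochhammer q q (N + r)) else 0) =
      1 / qPochhammer (-q) q N ^ 2 := by
    rw [← sum_baileyAlpha hq, tsum_eq_sum (s := range (N + 1)) fun r hr => if_neg hr]
    exact sum_congr rfl fun r hr => if_pos hr
  simp only [fin, one_div] at lim
  have e := tendsto_nhds_unique lim (((tendsto_qPochhammer hq (-q)).pow 2).inv₀ (pow_ne_zero 2 hV))
  rw [tsum_div_const] at e
  field_simp at e ⊢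
  linear_combination e

/-- The double series obtained by inserting the Bailey pair into `∑ q^{n²} β_n`. -/
noncomputable def baileyDoubleTerm (q : ℂ) (p : ℕ × ℕ) : ℂ :=
  q ^ p.1 ^ 2 * baileyAlpha q p.1 * durfeeTerm q (2 * p.1) p.2

theorem summable_baileyDoubleTerm {q : ℂ} (hq : ‖q‖ < 1) : Summable (baileyDoubleTerm q) := by
  obtain ⟨K, -, hK⟩ := exists_norm_inv_qPochhammer_le hq hq
  have g := summable_geometric_of_lt_one (norm_nonneg q) hq
  refine .of_norm_bounded ((g.mul_left (4 * (1 - ‖q‖)⁻¹)).mul_of_nonneg (g.mul_left (K ^ 2))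
    (fun r => (norm_nonneg _).trans (norm_baileyAlpha_le hq r)) fun m => by positivity) ?_
  rintro ⟨r, m⟩
  rw [baileyDoubleTerm, norm_mul, norm_mul]
  refine mul_le_mul ?_ (norm_durfeeTerm_le hq hK _ m) (norm_nonneg _)
    ((norm_nonneg _).trans (norm_baileyAlpha_le hq r))
  refine (mul_le_of_le_one_left (norm_nonneg _) ?_).trans (norm_baileyAlpha_le hq r)
  rw [norm_pow]
  exact pow_le_one₀ (norm_nonneg _) hq.le

/-- With `n = r + m`, the exponents match because `n² = r² + m(m + 2r)`. -/
theorem sum_antidiagonal_baileyDoubleTerm {q : ℂ} (hq : ‖q‖ < 1) (n : ℕ) :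
    ∑ p ∈ antidiagonal n, baileyDoubleTerm q p = mockF3Term q n := by
  rw [mockF3Term, div_eq_mul_one_div, ← sum_baileyAlpha hq, mul_sum,
    Nat.sum_antidiagonal_eq_sum_range_succ_mk]
  refine sum_congr rfl fun r hr => ?_
  obtain ⟨d, rfl⟩ := Nat.exists_eq_add_of_le (Nat.lt_succ_iff.mp (mem_range.mp hr))
  simp only [baileyDoubleTerm, durfeeTerm]
  rw [show r + d - r = d by omega, show r + d + r = d + 2 * r by ring]
  ring

theorem summable_mockF3Term {q : ℂ} (hq : ‖q‖ < 1) : Summable (mockF3Term q) := by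
  obtain ⟨K, -, hK⟩ := exists_norm_inv_qPochhammer_le (x := -q) hq (by simpa using hq)
  refine .of_norm_bounded ((summable_geometric_of_lt_one (norm_nonneg q) hq).mul_left (K ^ 2))
    fun n => ?_
  rw [mockF3Term, sq (qPochhammer _ _ _)]
  exact norm_pow_div_le hq (hK n) (hK n) (by nlinarith [Nat.le_mul_self n])

theorem mockF3_eq_tsum_baileyAlpha {q : ℂ} (hq : ‖q‖ < 1) :
    mockF3 q = (qPochhammerInf q q)⁻¹ * ∑' r, q ^ r ^ 2 * baileyAlpha q r := by
  have s := summable_baileyDoubleTerm hq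
  have hs := (HasAntidiagonal.sigmaAntidiagonalEquivProd (A := ℕ)).summable_iff.mpr s
  have e1 : ∑' p, baileyDoubleTerm q p = mockF3 q := by
    rw [← HasAntidiagonal.sigmaAntidiagonalEquivProd.tsum_eq (baileyDoubleTerm q)]
    refine (hs.tsum_sigma' fun n => (hasSum_fintype _).summable).trans (tsum_congr fun n => ?_)
    rw [← sum_antidiagonal_baileyDoubleTerm hq, tsum_fintype]
    exact sum_coe_sort (antidiagonal n) (baileyDoubleTerm q)
  rw [← e1, s.tsum_prod, ← tsum_mul_left]
  refine tsum_congr fun r => ?_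
  simp only [baileyDoubleTerm]
  rw [tsum_mul_left, tsum_durfeeTerm hq, mul_comm]

/-! ### The bilateral series and the trisection -/

theorem zeta3_pow_three : zeta3 ^ 3 = 1 :=
  (Complex.isPrimitiveRoot_exp 3 three_ne_zero).pow_eq_one

theorem zeta3_ne_zero : zeta3 ≠ 0 := Complex.exp_ne_zero _

theorem one_add_zeta3_add_sq : 1 + zeta3 + zeta3 ^ 2 = 0 := by
  have h := (Complex.isPrimitiveRoot_exp 3 three_ne_zero).geom_sum_eq_zero (by norm_num)
  simpa [sum_range_succ, zeta3] using h

theorem norm_zeta3 : ‖zeta3‖ = 1 :=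
  (Complex.isPrimitiveRoot_exp 3 three_ne_zero).norm'_eq_one three_ne_zero

theorem one_add_zeta3_pow_add_inv (n : ℕ) :
    1 + zeta3 ^ n + (zeta3 ^ n)⁻¹ = if 3 ∣ n then 3 else 0 := by
  have h3 := zeta3_pow_three
  have hs := one_add_zeta3_add_sq
  have hz := zeta3_ne_zero
  have hm : zeta3 ^ n = zeta3 ^ (n % 3) := pow_eq_pow_mod n h3
  rw [hm]
  have : n % 3 < 3 := Nat.mod_lt _ three_pos
  split_ifs with h
  · rw [Nat.mod_eq_zero_of_dvd h]; norm_num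
  · have h' : n % 3 = 1 ∨ n % 3 = 2 := by omega
    rcases h' with h' | h' <;> rw [h'] <;> field_simp
    · linear_combination hs
    · linear_combination hs + zeta3 * h3

theorem one_add_zpow_ne_zero {q : ℂ} (hq0 : q ≠ 0) (hq : ‖q‖ < 1) (n : ℤ) : 1 + q ^ n ≠ 0 := by
  obtain ⟨m, rfl | rfl⟩ := n.eq_nat_or_neg
  · exact_mod_cast one_add_pow_ne_zero hq m
  · intro h
    apply one_add_pow_ne_zero hq m
    rw [zpow_neg, zpow_natCast] at h
    have := pow_ne_zero m hq0
    field_simp at h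
    linear_combination h

theorem bilateralTerm_natCast {q : ℂ} (n : ℕ) :
    bilateralTerm q n = 4⁻¹ * (zeta3 ^ n * baileyAlpha q n + if n = 0 then 1 else 0) := by
  cases n with
  | zero => norm_num [bilateralTerm, baileyAlpha]
  | succ n =>
    have e : ((n + 1 : ℕ) : ℤ) * ((n + 1 : ℕ) + 1) / 2 = ((n + 1) * (n + 1 + 1) / 2 : ℕ) := by
      push_cast; rfl
    rw [bilateralTerm, e, zpow_natCast, zpow_natCast, zpow_natCast, zpow_natCast, baileyAlpha,
      if_neg n.succ_ne_zero]
    ring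

/-- Multiplying numerator and denominator by `q^n` shows that, apart from the power of `ζ₃`, the
summand is invariant under `n ↦ -n`. -/
theorem bilateralTerm_neg_succ {q : ℂ} (hq0 : q ≠ 0) (hq : ‖q‖ < 1) (n : ℕ) :
    bilateralTerm q (-(n + 1 : ℕ)) = 4⁻¹ * ((zeta3 ^ (n + 1))⁻¹ * baileyAlpha q (n + 1)) := by
  have e : (-((n + 1 : ℕ) : ℤ)) * (-((n + 1 : ℕ) : ℤ) + 1) / 2 = (n * (n + 1) / 2 : ℕ) := by
    push_cast
    congr 1
    ring
  have h1 := one_add_pow_ne_zero hq (n + 1)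
  have h2 : q ^ (n + 1) + 1 ≠ 0 := by rwa [add_comm]
  have h3 := pow_ne_zero (n + 1) hq0
  have h4 : ((-1 : ℂ) ^ (n + 1))⁻¹ = (-1) ^ (n + 1) := by
    rw [← inv_pow]; norm_num
  rw [bilateralTerm, e, zpow_neg, zpow_neg, zpow_neg, zpow_natCast, zpow_natCast, zpow_natCast,
    zpow_natCast, baileyAlpha, triangle_succ, pow_add q (n * (n + 1) / 2), h4]
  have h5 : 1 + (q ^ (n + 1))⁻¹ = (1 + q ^ (n + 1)) / q ^ (n + 1) := by
    field_simp
    ring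
  rw [h5]
  have := pow_ne_zero (n + 1) zeta3_ne_zero
  field_simp

theorem summable_mul_baileyAlpha {q : ℂ} (hq : ‖q‖ < 1) {c : ℕ → ℂ} (hc : ∀ n, ‖c n‖ = 1) :
    Summable fun n => c n * baileyAlpha q n :=
  .of_norm_bounded (summable_baileyAlpha hq).norm fun n => by rw [norm_mul, hc, one_mul]

theorem hasSum_bilateralTerm {q : ℂ} (hq0 : q ≠ 0) (hq : ‖q‖ < 1) :
    HasSum (bilateralTerm q)
      (4⁻¹ * ∑' n, (zeta3 ^ n + (zeta3 ^ n)⁻¹) * baileyAlpha q n) := by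
  have s1 := summable_mul_baileyAlpha (c := fun n => zeta3 ^ n) hq fun n => by simp [norm_zeta3]
  have s2 := summable_mul_baileyAlpha (c := fun n => (zeta3 ^ n)⁻¹) hq
    fun n => by simp [norm_zeta3]
  -- The two one-sided series both count `n = 0`, but the bilateral one has it once, with value
  -- `1/2`; the `+ 1` is the second copy of `α_0`.
  have e : 4⁻¹ * ∑' n, (zeta3 ^ n + (zeta3 ^ n)⁻¹) * baileyAlpha q n =
      4⁻¹ * (∑' n, zeta3 ^ n * baileyAlpha q n + 1) +
      4⁻¹ * ∑' n, (zeta3 ^ (n + 1))⁻¹ * baileyAlpha q (n + 1) := by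
    simp only [add_mul]
    rw [s1.tsum_add s2, s2.tsum_eq_zero_add]
    simp only [pow_zero, inv_one, baileyAlpha]
    ring
  rw [e]
  refine HasSum.of_nat_of_neg_add_one ?_ ?_
  · simp only [bilateralTerm_natCast]
    exact (s1.hasSum.add (hasSum_ite_eq 0 1)).mul_left _
  · have h := ((summable_nat_add_iff 1).mpr s2).hasSum.mul_left 4⁻¹
    refine h.congr_fun ?_
    intro n
    rw [← bilateralTerm_neg_succ hq0 hq]
    simp

/-- Rests on `3r² + 3r(r+1)/2 = 3r(3r+1)/2` and `(-1)^{3r} = (-1)^r`. -/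
theorem pow_mul_baileyAlpha_cube (q : ℂ) (r : ℕ) :
    (q ^ 3) ^ r ^ 2 * baileyAlpha (q ^ 3) r = baileyAlpha q (3 * r) := by
  cases r with
  | zero => simp [baileyAlpha]
  | succ r =>
    have e : (3 * r + 2 + 1) * (3 * r + 2 + 1 + 1) / 2 =
        3 * (r + 1) ^ 2 + 3 * ((r + 1) * (r + 1 + 1) / 2) := by
      obtain ⟨t, ht⟩ : 2 ∣ (r + 1) * (r + 1 + 1) := (Nat.even_mul_succ_self (r + 1)).two_dvd
      rw [ht, Nat.mul_div_cancel_left t two_pos]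
      apply Nat.div_eq_of_eq_mul_left two_pos
      linear_combination 3 * ht
    have h : (-1 : ℂ) ^ (3 * r + 2 + 1) = (-1) ^ (r + 1) := by
      rw [show 3 * r + 2 + 1 = 3 * (r + 1) by ring, pow_mul]; norm_num
    rw [show 3 * (r + 1) = 3 * r + 2 + 1 by ring, baileyAlpha, baileyAlpha, e, h, pow_add q,
      ← pow_mul, ← pow_mul, ← pow_mul, show 3 * r + 2 + 1 = 3 * (r + 1) by ring]
    ring

theorem tsum_baileyAlpha_three_mul {q : ℂ} (hq : ‖q‖ < 1) :
    ∑' r, baileyAlpha q (3 * r) = 3⁻¹ * (∑' n, baileyAlpha q n +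
      ∑' n, (zeta3 ^ n + (zeta3 ^ n)⁻¹) * baileyAlpha q n) := by
  have s1 := summable_mul_baileyAlpha (c := fun n => zeta3 ^ n) hq fun n => by simp [norm_zeta3]
  have s2 := summable_mul_baileyAlpha (c := fun n => (zeta3 ^ n)⁻¹) hq
    fun n => by simp [norm_zeta3]
  have s3 : Summable fun n => (zeta3 ^ n + (zeta3 ^ n)⁻¹) * baileyAlpha q n := by
    simpa only [add_mul] using s1.add s2
  rw [← (summable_baileyAlpha hq).tsum_add s3, ← tsum_mul_left]
  have inj : Function.Injective fun r : ℕ => 3 * r := fun a b h => by simpa using h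
  have h (n : ℕ) : 3⁻¹ * (baileyAlpha q n + (zeta3 ^ n + (zeta3 ^ n)⁻¹) * baileyAlpha q n) =
      if 3 ∣ n then baileyAlpha q n else 0 := by
    have e := one_add_zeta3_pow_add_inv n
    split_ifs at e ⊢ <;> linear_combination 3⁻¹ * baileyAlpha q n * e
  simp only [h]
  rw [← inj.tsum_eq (f := fun n => if 3 ∣ n then baileyAlpha q n else 0)]
  · simp
  · intro n hn
    have : 3 ∣ n := by
      by_contra h3
      exact hn (if_neg h3)
    obtain ⟨r, rfl⟩ := this
    exact ⟨r, rfl⟩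

theorem mainTheorem2 (q : ℂ) (hq0 : q ≠ 0) (hq1 : ‖q‖ < 1) :
    -- the infinite products converge and no denominator vanishes
    (∀ a : ℕ, 1 ≤ a → Multipliable (fun i : ℕ => 1 - q ^ (a * (i + 1))) ∧ eulerJ a q ≠ 0) ∧
    Multipliable (fun i : ℕ => 1 - (q ^ 3) ^ i * q ^ 3) ∧
    qPochhammerInf (q ^ 3) (q ^ 3) ≠ 0 ∧
    (∀ n : ℕ, qPochhammer (-(q ^ 3)) (q ^ 3) n ≠ 0) ∧
    (∀ n : ℤ, 1 + q ^ n ≠ 0) ∧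
    -- both series converge absolutely
    Summable (mockF3Term (q ^ 3)) ∧
    Summable (bilateralTerm q) ∧
    -- the identity
    mockF3 (q ^ 3) =
      1 / 3 * (eulerJ 1 q ^ 4 / (eulerJ 3 q * eulerJ 2 q ^ 2)) +
        4 / 3 * (1 / qPochhammerInf (q ^ 3) (q ^ 3)) * ∑' n : ℤ, bilateralTerm q n := by
  have h3 : ‖q ^ 3‖ < 1 := norm_pow_lt_one hq1 three_ne_zero
  have hJ := qPochhammerInf_ne_zero h3 h3
  refine ⟨fun a ha => ?_, multipliable_qPochhammerInf h3 _, hJ,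
    qPochhammer_ne_zero h3 (by simpa only [norm_neg] using h3), one_add_zpow_ne_zero hq0 hq1,
    summable_mockF3Term h3, (hasSum_bilateralTerm hq0 hq1).summable, ?_⟩
  · have hqa : ‖q ^ a‖ < 1 := norm_pow_lt_one hq1 (Nat.one_le_iff_ne_zero.mp ha)
    rw [eulerJ_eq_qPochhammerInf]
    simp only [eulerJ_factor]
    exact ⟨multipliable_qPochhammerInf hqa _, qPochhammerInf_ne_zero hqa hqa⟩
  · have hU := qPochhammerInf_ne_zero hq1 hq1
    have hV := qPochhammerInf_ne_zero (x := -q) hq1 (by simpa using hq1)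
    rw [mockF3_eq_tsum_baileyAlpha h3, (hasSum_bilateralTerm hq0 hq1).tsum_eq, eulerJ_two_eq hq1,
      eulerJ_eq_qPochhammerInf 3, eulerJ_eq_qPochhammerInf 1, pow_one]
    simp only [pow_mul_baileyAlpha_cube]
    rw [tsum_baileyAlpha_three_mul hq1, tsum_baileyAlpha hq1]
    field_simp
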